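/- A permutation $\pi=\pi_1\cdots\pi_n$ of $\{1,\dots,n\}$ avoids a pattern $\tau=\tau_1\cdots\tau_k$ if no subsequence $\pi_{i_1}\cdots\pi_{i_k}$ with $i_1<\cdots<i_k$ is order-isomorphic to $\tau$. Let $T=\{1324,2341,1243\}$, let $S_n(T)$ be the set of permutations of $\{1,\dots,n\}$ that avoid every pattern in $T$, and let $F_T(x)=\sum_{n\ge 0}|S_n(T)|\,x^n$. Let $C(x)=\sum_{n\ge 0}\frac{1}{n+1}\binom{2n}{n}x^n=\frac{1-\sqrt{1-4x}}{2x}$ be the generating function of the Catalan numbers. Then, as formal power series, $$F_T(x)=\frac{(1-7x+19x^2-25x^3+13x^4+4x^5-5x^6+x^7)\,C(x)-1+7x-19x^2+23x^3-7x^4-7x^5+4x^6}{x(1-x)^2(1-3x+x^2)(1-x-x^2)}.$$ -/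

import Mathlib

open scoped PowerSeries LaurentSeries

/-- The word `w` contains the pattern `τ` (a permutation in one-line notation): some subsequence
of `w`, at positions `f 0 < f 1 < ... < f (k - 1)`, is order-isomorphic to `τ`. -/
def ContainsPattern {n k : ℕ} (w : Fin n → Fin n) (τ : Fin k → ℕ) : Prop :=
  ∃ f : Fin k → Fin n, StrictMono f ∧ ∀ i j : Fin k, w (f i) < w (f j) ↔ τ i < τ j

/-- `S_n(T)`: the permutations of an `n`-element chain, `σ` being read as the word
`σ 0, σ 1, ..., σ (n - 1)`, that contain none of the patterns in `T`. -/
def avoiders {k : ℕ} (T : Set (Fin k → ℕ)) (n : ℕ) : Set (Equiv.Perm (Fin n)) :=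
  {σ | ∀ τ ∈ T, ¬ ContainsPattern σ τ}

/-- The generating function `F_T(x) = ∑_{n ≥ 0} |S_n(T)| x ^ n`. -/
noncomputable def avoiderSeries {k : ℕ} (T : Set (Fin k → ℕ)) : ℚ⟦X⟧ :=
  PowerSeries.mk fun n => ((avoiders T n).ncard : ℚ)

/-- The generating function `C(x) = ∑_{n ≥ 0} C_n x ^ n` of the Catalan numbers. -/
noncomputable def catalanGF : ℚ⟦X⟧ :=
  PowerSeries.mk fun n => (catalan n : ℚ)

/-! Avoiders are grown by inserting leftmost letters, a word being stored as the relation "a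
precedes b" on its values. A gap is active if the letter inserted there completes no pattern. For
every nonempty avoider the active gaps are a block of `k` top gaps and one lower gap `s`. Six
families of labels record `k` and just enough about the word to determine the label of each child:
`I` increasing words, `J` words whose top letters are each preceded by all smaller ones, `D` gap 0
active and maximum first, `A` gap 0 active and maximum neither first nor last, `E` maximum preceded
exactly by the letters below `s`, `c` a self-reproducing family. Hence a generating tree
(`extensionCount_eq_labelCount`, `ncard_avoiders_succ`).

The `c` nodes form a Catalan tree, with series powers of C (`labelGF_c`). The other families satisfy
linear recurrences in `k`, solved in `labelGF_E`, `labelGF_D_solution`, `labelGF_J_solution` and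
`labelGF_I_solution`. Substituting x = (C - 1)/C² makes the remaining elimination rational in C. -/

/-! ### Words as precedence relations, and insertion of a leftmost letter. -/

/-- The shift of letters that makes room for a new letter `v`. -/
def shiftLetter (v x : ℕ) : ℕ := if x < v then x else x + 1

/-- `B a b` means that the letter `a` precedes `b`; a new leftmost letter `v` is inserted. -/
def insertLeft (n : ℕ) (B : ℕ → ℕ → Prop) (v a b : ℕ) : Prop :=
  (a = v ∧ b ≠ v ∧ b ≤ n) ∨ ∃ x y, B x y ∧ a = shiftLetter v x ∧ b = shiftLetter v y

/-- A new leftmost letter of value `g` completes none of `1324`, `1243`, `2341`. -/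
def Active (B : ℕ → ℕ → Prop) (g : ℕ) : Prop :=
  ∀ a b c, B a b → B b c →
    ¬ (g ≤ b ∧ b < a ∧ a < c) ∧ ¬ (g ≤ a ∧ a < c ∧ c < b) ∧ ¬ (c < g ∧ g ≤ a ∧ a < b)

/-- After a new leftmost letter `v`, the gap `g ≤ v` is closed by a pair of older letters. -/
def Closes (B : ℕ → ℕ → Prop) (v g : ℕ) : Prop :=
  ∃ x y, B x y ∧ ((x < v ∧ v ≤ y ∧ g ≤ x) ∨ (v ≤ y ∧ y < x) ∨ (v ≤ x ∧ y < g))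

/-- `B` is a strict total relation on the letters below `n`. -/
structure IsWord (n : ℕ) (B : ℕ → ℕ → Prop) : Prop where
  lt_left : ∀ {a b}, B a b → a < n
  lt_right : ∀ {a b}, B a b → b < n
  asymm : ∀ {a b}, B a b → ¬ B b a
  total : ∀ {a b}, a < n → b < n → a ≠ b → B a b ∨ B b a

lemma insertLeft_shift {n : ℕ} {B : ℕ → ℕ → Prop} {v x y : ℕ} (h : B x y) :
    insertLeft n B v (shiftLetter v x) (shiftLetter v y) := Or.inr ⟨x, y, h, rfl, rfl⟩

lemma insertLeft_of_lt {n : ℕ} {B : ℕ → ℕ → Prop} {v x y : ℕ} (h : B x y) (hx : v ≤ x)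
    (hy : y < v) : insertLeft n B v (x + 1) y :=
  Or.inr ⟨x, y, h, by simp [shiftLetter]; omega, by simp [shiftLetter]; omega⟩

lemma insertLeft_of_le {n : ℕ} {B : ℕ → ℕ → Prop} {v x y : ℕ} (h : B x y) (hx : v ≤ x)
    (hy : v ≤ y) : insertLeft n B v (x + 1) (y + 1) :=
  Or.inr ⟨x, y, h, by simp [shiftLetter]; omega, by simp [shiftLetter]; omega⟩

lemma insertLeft_head {n : ℕ} {B : ℕ → ℕ → Prop} {v b : ℕ} (h : b ≠ v) (hb : b ≤ n) :
    insertLeft n B v v b := Or.inl ⟨rfl, h, hb⟩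

lemma shiftLetter_ne (v x : ℕ) : shiftLetter v x ≠ v := by
  unfold shiftLetter; split_ifs <;> omega

lemma shiftLetter_lt_shiftLetter {v x y : ℕ} : shiftLetter v x < shiftLetter v y ↔ x < y := by
  unfold shiftLetter; split_ifs <;> omega

lemma shiftLetter_injective (v : ℕ) : Function.Injective (shiftLetter v) := by
  intro x y h; unfold shiftLetter at h; split_ifs at h <;> omega

lemma exists_shiftLetter {n v a : ℕ} (hv : v ≤ n) (ha : a < n + 1) (h : a ≠ v) :
    ∃ x < n, a = shiftLetter v x := by
  unfold shiftLetter
  by_cases h' : a < v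
  · exact ⟨a, by omega, by simp [h']⟩
  · exact ⟨a - 1, by omega, by rw [if_neg (by omega)]; omega⟩

lemma insertLeft_shift_iff {n : ℕ} {B : ℕ → ℕ → Prop} {v x y : ℕ} :
    insertLeft n B v (shiftLetter v x) (shiftLetter v y) ↔ B x y := by
  constructor
  · rintro (⟨h, -⟩ | ⟨a, b, h, ha, hb⟩)
    · exact absurd h (shiftLetter_ne v x)
    · rwa [shiftLetter_injective v ha, shiftLetter_injective v hb]
  · exact insertLeft_shift

lemma IsWord.insertLeft {n v : ℕ} {B : ℕ → ℕ → Prop} (hB : IsWord n B) (hv : v ≤ n) :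
    IsWord (n + 1) (insertLeft n B v) where
  lt_left := by
    rintro a b (⟨rfl, -, -⟩ | ⟨x, y, h, rfl, rfl⟩)
    · omega
    · have := hB.lt_left h; unfold shiftLetter; split_ifs <;> omega
  lt_right := by
    rintro a b (⟨rfl, -, _⟩ | ⟨x, y, h, rfl, rfl⟩)
    · omega
    · have := hB.lt_right h; unfold shiftLetter; split_ifs <;> omega
  asymm := by
    rintro a b (⟨rfl, h1, -⟩ | ⟨x, y, h, rfl, rfl⟩)
    · rintro (⟨rfl, -⟩ | ⟨x, y, h, rfl, h2⟩)
      · exact h1 rfl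
      · exact shiftLetter_ne _ _ h2.symm
    · rw [insertLeft_shift_iff]
      exact hB.asymm h
  total := by
    intro a b ha hb hab
    by_cases h1 : a = v
    · subst h1; exact Or.inl (insertLeft_head (Ne.symm hab) (by omega))
    by_cases h2 : b = v
    · subst h2; exact Or.inr (insertLeft_head hab (by omega))
    obtain ⟨x, hx, rfl⟩ := exists_shiftLetter hv ha h1
    obtain ⟨y, hy, rfl⟩ := exists_shiftLetter hv hb h2
    rw [insertLeft_shift_iff, insertLeft_shift_iff]
    exact hB.total hx hy (fun h => hab (by rw [h]))

/-- Here `h` is the old gap containing the new gap `g`. As `v` is leftmost in the word, an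
occurrence created by a further letter `g` either uses old letters only or has `v` as its second
letter. -/
lemma active_insertLeft_aux {n v g h : ℕ} {B : ℕ → ℕ → Prop}
    (hgh : ∀ x, g ≤ shiftLetter v x ↔ h ≤ x) :
    Active (insertLeft n B v) g ↔ Active B h ∧
      ∀ b c, insertLeft n B v v b → insertLeft n B v b c →
    ¬ (g ≤ b ∧ b < v ∧ v < c) ∧ ¬ (g ≤ v ∧ v < c ∧ c < b) ∧ ¬ (c < g ∧ g ≤ v ∧ v < b) := by
  have hlt : ∀ x, shiftLetter v x < g ↔ x < h := fun x => by
    rw [← not_le, ← not_le, hgh]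
  constructor
  · intro H
    refine ⟨fun a b c hab hbc => ?_, fun b c => H v b c⟩
    have := H _ _ _ (insertLeft_shift (n := n) (v := v) hab) (insertLeft_shift hbc)
    simpa only [hgh, hlt, shiftLetter_lt_shiftLetter] using this
  · rintro ⟨H, K⟩ a b c (⟨rfl, h1, h2⟩ | ⟨x, y, hxy, rfl, rfl⟩) hbc
    · exact K b c (Or.inl ⟨rfl, h1, h2⟩) hbc
    · obtain ⟨h1, -⟩ | ⟨y', z, hyz, h1, rfl⟩ := hbc
      · exact absurd h1 (shiftLetter_ne _ _)
      · obtain rfl := shiftLetter_injective v h1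
        have := H _ _ _ hxy hyz
        simpa only [hgh, hlt, shiftLetter_lt_shiftLetter] using this

/-- All three patterns start with an ascent, so `v` cannot follow a larger first letter in an
occurrence. -/
lemma active_insertLeft_of_lt {n v g : ℕ} {B : ℕ → ℕ → Prop} (h : v ≤ g) :
    Active (insertLeft n B v) (g + 1) ↔ Active B g := by
  rw [active_insertLeft_aux (h := g)]
  · refine and_iff_left fun b c _ _ => ⟨?_, ?_, ?_⟩ <;> omega
  · intro x; unfold shiftLetter; split_ifs <;> omega

/-- The three clauses of `Closes` are what is left of 1324, 1243 and 2341, in this order, once `v`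
plays the second letter. -/
lemma active_insertLeft_of_le {n v g : ℕ} {B : ℕ → ℕ → Prop} (hB : IsWord n B) (h : g ≤ v) :
    Active (insertLeft n B v) g ↔ Active B g ∧ ¬ Closes B v g := by
  rw [active_insertLeft_aux (h := g)]
  · refine and_congr_right fun _ => ⟨?_, ?_⟩
    · rintro H ⟨x, y, hxy, hc⟩
      have hx := hB.lt_left hxy
      have := H (shiftLetter v x) (shiftLetter v y) (insertLeft_head (shiftLetter_ne _ _) (by
        unfold shiftLetter; split_ifs <;> omega)) (insertLeft_shift hxy)
      unfold shiftLetter at this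
      split_ifs at this <;> omega
    · rintro H b c - (⟨rfl, -, -⟩ | ⟨x, y, hxy, rfl, rfl⟩)
      · refine ⟨?_, ?_, ?_⟩ <;> omega
      · have : ¬ ((x < v ∧ v ≤ y ∧ g ≤ x) ∨ (v ≤ y ∧ y < x) ∨ (v ≤ x ∧ y < g)) :=
          fun hc => H ⟨x, y, hxy, hc⟩
        unfold shiftLetter
        split_ifs <;> omega
  · intro x; unfold shiftLetter; split_ifs <;> omega

/-! ### Active gaps and their evolution under insertion. -/

open Classical in
/-- The number of ways to insert `d` further leftmost letters without creating a pattern. -/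
noncomputable def extensionCount : ℕ → ℕ → (ℕ → ℕ → Prop) → ℕ
  | 0, _, _ => 1
  | d + 1, n, B => ∑ g ∈ Finset.range (n + 1),
      if Active B g then extensionCount d (n + 1) (insertLeft n B g) else 0

/-- The active gaps are `n, n - 1, …, n - k + 1` and `s`. -/
def ActiveGaps (n : ℕ) (B : ℕ → ℕ → Prop) (k s : ℕ) : Prop :=
  s + k ≤ n ∧ ∀ g ≤ n, Active B g ↔ n < g + k ∨ g = s

lemma extensionCount_succ {n k s : ℕ} {B : ℕ → ℕ → Prop} (h : ActiveGaps n B k s) (d : ℕ) :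
    extensionCount (d + 1) n B =
      ∑ j ∈ Finset.range k, extensionCount d (n + 1) (insertLeft n B (n - j)) +
        extensionCount d (n + 1) (insertLeft n B s) := by
  classical
  obtain ⟨hs, h⟩ := h
  have h1 : ∀ g ∈ Finset.range (n + 1),
      (if Active B g then extensionCount d (n + 1) (insertLeft n B g) else 0) =
      (if n < g + k ∨ g = s then extensionCount d (n + 1) (insertLeft n B g) else 0) := by
    intro g hg
    simp only [h g (by simpa [Nat.lt_succ_iff] using hg)]
  -- Reflection reindexes the gaps by the number `j` of letters above the inserted one.
  rw [extensionCount, Finset.sum_congr rfl h1, ← Finset.sum_range_reflect,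
    ← Finset.sum_filter]
  have h2 : (Finset.range (n + 1)).filter (fun j => n < n + 1 - 1 - j + k ∨ n + 1 - 1 - j = s) =
      insert (n - s) (Finset.range k) := by
    ext j; simp only [Finset.mem_filter, Finset.mem_range, Finset.mem_insert]; omega
  rw [h2, Finset.sum_insert (by simp; omega), add_comm]
  congr 2
  · congr 1; omega

section Gaps

variable {n k s : ℕ} {B : ℕ → ℕ → Prop}

/-- Each clause of `Closes` needs an old letter at least `v`; a new maximum therefore closes nothing
and splits the top gap in two. -/
lemma activeGaps_insertLeft_top (hB : IsWord n B) (h : ActiveGaps n B k s)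
    (hk : 1 ≤ k) : ActiveGaps (n + 1) (insertLeft n B n) (k + 1) s := by
  obtain ⟨hs, h⟩ := h
  refine ⟨by omega, fun g hg => ?_⟩
  rcases Nat.lt_or_ge n g with h1 | h1
  · obtain rfl : g = n + 1 := by omega
    rw [active_insertLeft_of_lt le_rfl, h n le_rfl]; omega
  · rw [active_insertLeft_of_le hB h1, h g h1, and_iff_left]
    · omega
    · rintro ⟨x, y, hxy, hc⟩
      have := hB.lt_left hxy
      have := hB.lt_right hxy
      omega

/-- Only the `j + 1` gaps above the new letter survive; the lowest of them takes the role of `s`. -/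
lemma activeGaps_insertLeft_of_closes {j : ℕ} (hB : IsWord n B) (h : ActiveGaps n B k s)
    (hj : j < k) (hc : ∀ g ≤ n - j, n < g + k ∨ g = s → Closes B (n - j) g) :
    ActiveGaps (n + 1) (insertLeft n B (n - j)) j (n + 1 - j) := by
  obtain ⟨hs, h⟩ := h
  refine ⟨by omega, fun g hg => ?_⟩
  rcases Nat.lt_or_ge (n - j) g with h1 | h1
  · obtain ⟨g, rfl⟩ : ∃ g', g = g' + 1 := ⟨g - 1, by omega⟩
    rw [active_insertLeft_of_lt (by omega), h g (by omega)]; omega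
  · rw [active_insertLeft_of_le hB h1, h g (by omega)]
    have := hc g h1
    constructor
    · tauto
    · omega

lemma activeGaps_insertLeft_last (hB : IsWord n B) (h : ActiveGaps n B k s)
    (hc : Closes B s s) : ActiveGaps (n + 1) (insertLeft n B s) k (s + 1) := by
  obtain ⟨hs, h⟩ := h
  refine ⟨by omega, fun g hg => ?_⟩
  rcases Nat.lt_or_ge s g with h1 | h1
  · obtain ⟨g, rfl⟩ : ∃ g', g = g' + 1 := ⟨g - 1, by omega⟩
    rw [active_insertLeft_of_lt (by omega), h g (by omega)]; omega
  · rw [active_insertLeft_of_le hB h1, h g (by omega)]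
    constructor
    · rintro ⟨h2 | rfl, h3⟩
      · omega
      · exact absurd hc h3
    · omega

/-- Both halves of the split gap survive, and the half just below the new letter becomes the new
`s`. -/
lemma activeGaps_insertLeft_of_not_closes {j : ℕ} (hB : IsWord n B) (h : ActiveGaps n B k s)
    (hj : j < k) (hc : ∀ g < n - j, n < g + k ∨ g = s → Closes B (n - j) g)
    (hn : ¬ Closes B (n - j) (n - j)) :
    ActiveGaps (n + 1) (insertLeft n B (n - j)) (j + 1) (n - j) := by
  obtain ⟨hs, h⟩ := h
  refine ⟨by omega, fun g hg => ?_⟩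
  rcases Nat.lt_or_ge (n - j) g with h1 | h1
  · obtain ⟨g, rfl⟩ : ∃ g', g = g' + 1 := ⟨g - 1, by omega⟩
    rw [active_insertLeft_of_lt (by omega), h g (by omega)]; omega
  · rw [active_insertLeft_of_le hB h1, h g (by omega)]
    rcases h1.lt_or_eq with h2 | rfl
    · have := hc g h2
      constructor
      · tauto
      · omega
    · exact ⟨fun _ => Or.inr rfl, fun _ => ⟨Or.inl (by omega), hn⟩⟩

/-- The old `s` outlives the rest of the block: what remains is `s` and the two gaps above the new
letter. -/
lemma activeGaps_insertLeft_second (hB : IsWord n B) (h : ActiveGaps n B k s) (hk : 2 ≤ k)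
    (hc : ∀ g ≤ n - 1, n < g + k → Closes B (n - 1) g) (hn : ¬ Closes B (n - 1) s) :
    ActiveGaps (n + 1) (insertLeft n B (n - 1)) 2 s := by
  obtain ⟨hs, h⟩ := h
  refine ⟨by omega, fun g hg => ?_⟩
  rcases Nat.lt_or_ge (n - 1) g with h1 | h1
  · obtain ⟨g, rfl⟩ : ∃ g', g = g' + 1 := ⟨g - 1, by omega⟩
    rw [active_insertLeft_of_lt (by omega), h g (by omega)]; omega
  · rw [active_insertLeft_of_le hB h1, h g (by omega)]
    constructor
    · rintro ⟨h2 | rfl, h3⟩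
      · exact absurd (hc g h1 h2) h3
      · exact Or.inr rfl
    · rintro (h2 | rfl)
      · omega
      · exact ⟨Or.inr rfl, hn⟩

end Gaps

/-! ### Labels of the generating tree. -/

/-- The node types of the generating tree. -/
inductive Label
  | c (k : ℕ) | D (k : ℕ) | E (k : ℕ) | A | J (k : ℕ) | I (k : ℕ)

namespace Label

/-- The number of children other than the last one. -/
def arity : Label → ℕ
  | c k => k | D k => k | E k => k | A => 2 | J k => k | I k => k

/-- The label of the word obtained by inserting a letter with `j` larger letters. -/
def child : Label → ℕ → Label
  | c k, 0 => c (k + 1)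
  | c _, j + 1 => c (j + 1)
  | D k, 0 => D (k + 1)
  | D _, 1 => A
  | D _, j + 2 => c (j + 2)
  | E k, 0 => c (k + 1)
  | E _, 1 => c 2
  | E _, j + 2 => c (j + 2)
  | A, 0 => D 3
  | A, _ + 1 => c 1
  | J k, 0 => c (k + 1)
  | J _, j + 1 => J (j + 2)
  | I k, 0 => D (k + 1)
  | I _, j + 1 => J (j + 2)

/-- The label of the word obtained by inserting a letter into the lowest active gap. -/
def last : Label → Label
  | c k => c k | D k => E k | E k => E k | A => c 2 | J k => J k | I k => I (k + 1)

/-- The features of a word of length `n` with lowest active gap `s` that determine its label. -/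
def Holds (n : ℕ) (B : ℕ → ℕ → Prop) (s : ℕ) : Label → Prop
  | c k => 1 ≤ k ∧ 1 ≤ s ∧ (3 ≤ k → B (n - 1) (n - 2)) ∧
      ∃ x, x + k ≤ n ∧ B (n - 1) x ∧ (x < s ∨ ∃ a, s ≤ a ∧ B a (n - 1))
  | D k => 2 ≤ k ∧ s = 0 ∧ ∀ y, ¬ B y (n - 1)
  | E k => 2 ≤ k ∧ 1 ≤ s ∧ ∀ y, B y (n - 1) ↔ y < s
  | A => s = 0 ∧ (∃ a, B a (n - 1)) ∧ ∃ x, B (n - 1) x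
  | J k => 2 ≤ k ∧ 1 ≤ s ∧ (∀ y z, y < z → n < z + k → z < n → B y z) ∧
      ∃ y z, s ≤ y ∧ z < y ∧ B y z
  | I k => 1 ≤ k ∧ n = k ∧ s = 0 ∧ ∀ y z, y < z → z < n → B y z

end Label

/-- The word `B` of length `n` has the given label. -/
def Labels (L : Label) (n : ℕ) (B : ℕ → ℕ → Prop) : Prop :=
  IsWord n B ∧ ∃ s, ActiveGaps n B L.arity s ∧ L.Holds n B s

/-! ### Each label determines the labels of the children. -/

section Children

open Label

variable {n k s : ℕ} {B : ℕ → ℕ → Prop}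

lemma closes_of_descent {v g x y : ℕ} (h : B y x) (hv : v ≤ x) (hx : x < y) : Closes B v g :=
  ⟨y, x, h, Or.inr (Or.inl ⟨hv, hx⟩)⟩

/-- Inserting below at least two letters among which there is a descent. -/
lemma labels_c_of_descent {j x : ℕ} (hB : IsWord n B) (h : ActiveGaps n B k s) (hj : 2 ≤ j)
    (hjk : j < k) (hd : B (n - 1) (n - 2)) (hx : x + k ≤ n) (hx' : B (n - 1) x) :
    Labels (c j) (n + 1) (insertLeft n B (n - j)) := by
  have hs := h.1
  refine ⟨hB.insertLeft (by omega), n + 1 - j,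
    activeGaps_insertLeft_of_closes hB h hjk fun g _ _ =>
      closes_of_descent hd (by omega) (by omega), by omega, by omega, fun _ => ?_, x, by omega, ?_,
      Or.inl (by omega)⟩
  · have := insertLeft_of_le (n := n) (v := n - j) hd (by omega) (by omega)
    convert this using 1 <;> omega
  · have := insertLeft_of_lt (n := n) (v := n - j) hx' (by omega) (by omega)
    convert this using 1; omega

/-- Inserting a new maximum in front of a word whose gap `0` is closed. -/
lemma labels_c_top (hB : IsWord n B) (h : ActiveGaps n B k s) (hs : 1 ≤ s) (hk : 1 ≤ k) :
    Labels (c (k + 1)) (n + 1) (insertLeft n B n) := by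
  have := h.1
  exact ⟨hB.insertLeft le_rfl, s, activeGaps_insertLeft_top hB h hk, by omega, hs,
    fun _ => insertLeft_head (by omega) (by omega), 0, by omega,
    insertLeft_head (by omega) (by omega), Or.inl (by omega)⟩

lemma labels_D_top (hB : IsWord n B) (h : ActiveGaps n B k 0) (hk : 1 ≤ k) :
    Labels (D (k + 1)) (n + 1) (insertLeft n B n) := by
  have := h.1
  refine ⟨hB.insertLeft le_rfl, 0, activeGaps_insertLeft_top hB h hk, by omega, rfl, fun y hy => ?_⟩
  have hyn := (hB.insertLeft le_rfl).lt_left hy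
  have hne : y ≠ n := by
    rintro rfl
    exact (hB.insertLeft le_rfl).asymm hy hy
  exact (hB.insertLeft le_rfl).asymm hy (insertLeft_head hne (by omega))

/-- The letter `n - j - 1` precedes `n - j`, which closes every gap below the new letter through
1324. The gap just below it stays open, since closing it would need a descent starting at one of the
top letters. -/
lemma labels_J_of_increasing {j : ℕ} (hB : IsWord n B) (h : ActiveGaps n B k s) (hj : 1 ≤ j)
    (hjk : j < k) (hi : ∀ y z, y < z → n < z + k → z < n → B y z) :
    Labels (J (j + 1)) (n + 1) (insertLeft n B (n - j)) := by
  have hs := h.1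
  refine ⟨hB.insertLeft (by omega), n - j,
    activeGaps_insertLeft_of_not_closes hB h hjk (fun g hg _ => ?_) ?_,
    by omega, by omega, ?_, n - j, n - j - 1, le_rfl, by omega,
    insertLeft_head (by omega) (by omega)⟩
  · exact ⟨n - j - 1, n - j, hi _ _ (by omega) (by omega) (by omega), by omega⟩
  · rintro ⟨x, y, hxy, hc⟩
    have hx := hB.lt_left hxy
    have hy := hB.lt_right hxy
    have hyx : y < x := by omega
    exact hB.asymm hxy (hi y x hyx (by omega) hx)
  · intro y z hyz hz hzn
    rcases eq_or_ne y (n - j) with rfl | hy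
    · exact insertLeft_head (by omega) (by omega)
    obtain ⟨y, -, rfl⟩ := exists_shiftLetter (n := n) (v := n - j) (by omega) (by omega) hy
    obtain ⟨z, -, rfl⟩ := exists_shiftLetter (n := n) (v := n - j) (a := z) (by omega) (by omega)
      (by omega)
    rw [shiftLetter_lt_shiftLetter] at hyz
    refine insertLeft_shift (hi y z hyz ?_ ?_)
    all_goals unfold shiftLetter at hz hzn; split_ifs at hz hzn <;> omega

lemma labels_child_c (h : Labels (c k) n B) {j : ℕ} (hj : j < k) :
    Labels ((c k).child j) (n + 1) (insertLeft n B (n - j)) := by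
  obtain ⟨hB, s, hg, hk, hs, hd, x, hx, hBx, hx'⟩ := h
  have hsk := hg.1
  simp only [arity] at hsk hg
  match j with
  | 0 => exact labels_c_top hB hg hs hk
  | 1 =>
    show Labels (c 1) _ _
    refine ⟨hB.insertLeft (by omega), n + 1 - 1,
      activeGaps_insertLeft_of_closes hB hg hj fun g hg1 hg2 => ?_, by omega, by omega, by omega,
      x, by omega, ?_, Or.inl (by omega)⟩
    -- Gaps above `x` are closed by the maximum followed by `x` (2341). If `s` is not above `x`,
    -- then a letter `a ≥ s` before the maximum closes it (1324).
    · rcases hg2 with hg2 | rfl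
      · exact ⟨n - 1, x, hBx, by omega⟩
      · rcases hx' with hx' | ⟨a, ha, hBa⟩
        · exact ⟨n - 1, x, hBx, by omega⟩
        · have := hB.lt_left hBa
          have : a ≠ n - 1 := by rintro rfl; exact hB.asymm hBa hBa
          exact ⟨a, n - 1, hBa, by omega⟩
    · have := insertLeft_of_lt (n := n) (v := n - 1) hBx (by omega) (by omega)
      convert this using 1; omega
  | j + 2 =>
    exact labels_c_of_descent hB hg (by omega) hj (hd (by omega)) (by omega) hBx

lemma labels_last_c (h : Labels (c k) n B) :
    ∃ s, ActiveGaps n B k s ∧ Labels (c k) (n + 1) (insertLeft n B s) := by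
  obtain ⟨hB, s, hg, hk, hs, hd, x, hx, hBx, hx'⟩ := h
  have hsk := hg.1
  simp only [arity] at hsk hg
  have hxn : x ≠ n - 1 := by rintro rfl; exact hB.asymm hBx hBx
  refine ⟨s, hg, hB.insertLeft (by omega), s + 1,
    activeGaps_insertLeft_last hB hg ⟨n - 1, x, hBx, by omega⟩, hk, by omega, fun h3 => ?_,
    shiftLetter s x, ?_, ?_, ?_⟩
  · have := insertLeft_of_le (n := n) (v := s) (hd h3) (by omega) (by omega)
    convert this using 1 <;> omega
  · unfold shiftLetter; split_ifs <;> omega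
  · have := insertLeft_shift (n := n) (v := s) hBx
    convert this using 1; unfold shiftLetter; rw [if_neg (by omega)]; omega
  · rcases hx' with hx' | ⟨a, ha, hBa⟩
    · left; unfold shiftLetter; split_ifs; omega
    · refine Or.inr ⟨a + 1, by omega, ?_⟩
      have := insertLeft_of_le (n := n) (v := s) hBa ha (by omega)
      convert this using 1; omega

lemma labels_child_D (h : Labels (D k) n B) {j : ℕ} (hj : j < k) :
    Labels ((D k).child j) (n + 1) (insertLeft n B (n - j)) := by
  obtain ⟨hB, s, hg, hk, rfl, hd⟩ := h
  have hsk := hg.1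
  simp only [arity] at hsk hg
  have hfirst : ∀ y, y < n - 1 → B (n - 1) y := fun y hy =>
    (hB.total (by omega) (by omega) (by omega)).resolve_right (hd y)
  match j with
  | 0 => exact labels_D_top hB hg (by omega)
  | 1 =>
    refine ⟨hB.insertLeft (by omega), 0,
      activeGaps_insertLeft_second hB hg hk (fun g hg1 hg2 => ?_) ?_, rfl, ⟨n - 1, ?_⟩, 0, ?_⟩
    · exact ⟨n - 1, n - k, hfirst _ (by omega), by omega⟩
    -- With `v = n - 1` and `g = 0`, only 1324 could close the gap, and it needs a letter before the
    -- maximum.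
    · rintro ⟨x, y, hxy, hc⟩
      have := hB.lt_left hxy
      have := hB.lt_right hxy
      obtain rfl : y = n - 1 := by omega
      exact hd _ hxy
    · exact insertLeft_head (by omega) (by omega)
    · have := insertLeft_of_lt (n := n) (v := n - 1) (hfirst 0 (by omega)) (by omega) (by omega)
      convert this using 1; omega
  | j + 2 =>
    exact labels_c_of_descent hB hg (by omega) hj (hfirst _ (by omega))
      (show n - k + k ≤ n by omega) (hfirst _ (by omega))

lemma labels_last_D (h : Labels (D k) n B) :
    ∃ s, ActiveGaps n B k s ∧ Labels (E k) (n + 1) (insertLeft n B s) := by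
  obtain ⟨hB, s, hg, hk, rfl, hd⟩ := h
  have hsk := hg.1
  simp only [arity] at hsk hg
  have hfirst : B (n - 1) 0 :=
    (hB.total (by omega) (by omega) (by omega)).resolve_right (hd 0)
  refine ⟨0, hg, hB.insertLeft (by omega), 1,
    activeGaps_insertLeft_last hB hg ⟨n - 1, 0, hfirst, by omega⟩, hk, le_rfl, fun y => ?_⟩
  constructor
  · rintro (⟨rfl, -⟩ | ⟨a, b, hab, rfl, hb⟩)
    · omega
    · have : b = n - 1 := by unfold shiftLetter at hb; split_ifs at hb <;> omega
      exact absurd (this ▸ hab) (hd a)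
  · intro hy
    obtain rfl : y = 0 := by omega
    exact insertLeft_head (by omega) (by omega)

lemma labels_child_E (h : Labels (E k) n B) {j : ℕ} (hj : j < k) :
    Labels ((E k).child j) (n + 1) (insertLeft n B (n - j)) := by
  obtain ⟨hB, s, hg, hk, hs, hd⟩ := h
  have hsk := hg.1
  simp only [arity] at hsk hg
  have hfirst : ∀ y, y < n - 1 → s ≤ y → B (n - 1) y := fun y hy hsy =>
    (hB.total (by omega) (by omega) (by omega)).resolve_right fun h => by
      have := (hd y).1 h; omega
  have hfk := hfirst (n - k) (by omega) (by omega)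
  match j with
  | 0 => exact labels_c_top hB hg hs (by omega)
  | 1 =>
    refine ⟨hB.insertLeft (by omega), s,
      activeGaps_insertLeft_second hB hg hk (fun g hg1 hg2 => ?_) ?_, by omega, hs, by omega,
      n - k, by omega, ?_, Or.inr ⟨n - 1, by omega, insertLeft_head (by omega) (by omega)⟩⟩
    · exact ⟨n - 1, n - k, hfk, by omega⟩
    -- Closing `s` needs a letter `≥ s` before the maximum, or a letter `< s` after it; label `E`
    -- excludes both.
    · rintro ⟨x, y, hxy, hc⟩
      have := hB.lt_left hxy
      have := hB.lt_right hxy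
      have hcase : (y = n - 1 ∧ s ≤ x) ∨ (x = n - 1 ∧ y < s) := by omega
      rcases hcase with ⟨rfl, h1⟩ | ⟨rfl, h1⟩
      · have := (hd x).1 hxy; omega
      · exact hB.asymm hxy ((hd y).2 h1)
    · have := insertLeft_of_lt (n := n) (v := n - 1) hfk (by omega) (by omega)
      convert this using 1; omega
  | j + 2 =>
    exact labels_c_of_descent hB hg (by omega) hj (hfirst _ (by omega) (by omega))
      (show n - k + k ≤ n by omega) hfk

lemma labels_last_E (h : Labels (E k) n B) :
    ∃ s, ActiveGaps n B k s ∧ Labels (E k) (n + 1) (insertLeft n B s) := by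
  obtain ⟨hB, s, hg, hk, hs, hd⟩ := h
  have hsk := hg.1
  simp only [arity] at hsk hg
  have hfirst : B (n - 1) (n - k) :=
    (hB.total (by omega) (by omega) (by omega)).resolve_right fun h => by
      have := (hd _).1 h; omega
  refine ⟨s, hg, hB.insertLeft (by omega), s + 1,
    activeGaps_insertLeft_last hB hg ⟨n - 1, n - k, hfirst, by omega⟩, hk, by omega, fun y => ?_⟩
  have hn : n + 1 - 1 = shiftLetter s (n - 1) := by
    unfold shiftLetter; rw [if_neg (by omega)]; omega
  rcases eq_or_ne y s with rfl | hy
  · exact ⟨fun _ => by omega, fun _ => insertLeft_head (by omega) (by omega)⟩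
  rw [hn]
  constructor
  · rintro (⟨rfl, -⟩ | ⟨a, b, hab, rfl, hb⟩)
    · omega
    · rw [← shiftLetter_injective s hb] at hab
      have := (hd a).1 hab
      unfold shiftLetter; split_ifs; omega
  · intro hys
    have := insertLeft_shift (n := n) (v := s) ((hd y).2 (by omega))
    convert this using 1; unfold shiftLetter; rw [if_pos (by omega)]

lemma labels_child_A (h : Labels A n B) {j : ℕ} (hj : j < 2) :
    Labels (A.child j) (n + 1) (insertLeft n B (n - j)) := by
  obtain ⟨hB, s, hg, rfl, ⟨a, ha⟩, x, hx⟩ := h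
  have hsk := hg.1
  simp only [arity] at hsk hg
  have := hB.lt_left ha
  have : a ≠ n - 1 := by rintro rfl; exact hB.asymm ha ha
  have := hB.lt_right hx
  have : x ≠ n - 1 := by rintro rfl; exact hB.asymm hx hx
  match j with
  | 0 => exact labels_D_top hB hg (by omega)
  | 1 =>
    show Labels (c 1) _ _
    refine ⟨hB.insertLeft (by omega), n + 1 - 1,
      activeGaps_insertLeft_of_closes hB hg hj fun g hg1 hg2 => ?_, by omega, by omega, by omega,
      x, by omega, ?_, Or.inl (by omega)⟩
    · rcases hg2 with hg2 | rfl
      · exact ⟨n - 1, x, hx, by omega⟩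
      · exact ⟨a, n - 1, ha, by omega⟩
    · have := insertLeft_of_lt (n := n) (v := n - 1) hx (by omega) (by omega)
      convert this using 1; omega

lemma labels_last_A (h : Labels A n B) :
    ∃ s, ActiveGaps n B 2 s ∧ Labels (c 2) (n + 1) (insertLeft n B s) := by
  obtain ⟨hB, s, hg, rfl, ⟨a, ha⟩, x, hx⟩ := h
  have hsk := hg.1
  simp only [arity] at hsk hg
  have := hB.lt_left ha
  have : a ≠ n - 1 := by rintro rfl; exact hB.asymm ha ha
  have := hB.lt_right hx
  have : x ≠ n - 1 := by rintro rfl; exact hB.asymm hx hx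
  refine ⟨0, hg, hB.insertLeft (by omega), 1,
    activeGaps_insertLeft_last hB hg ⟨n - 1, x, hx, by omega⟩, by omega, le_rfl, by omega,
    x + 1, by omega, ?_, Or.inr ⟨a + 1, by omega, ?_⟩⟩
  · have := insertLeft_of_le (n := n) (v := 0) hx (by omega) (by omega)
    convert this using 1; omega
  · have := insertLeft_of_le (n := n) (v := 0) ha (by omega) (by omega)
    convert this using 1; omega

lemma labels_child_J (h : Labels (J k) n B) {j : ℕ} (hj : j < k) :
    Labels ((J k).child j) (n + 1) (insertLeft n B (n - j)) := by
  obtain ⟨hB, s, hg, hk, hs, hi, -⟩ := h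
  match j with
  | 0 => exact labels_c_top hB hg hs (by omega)
  | j + 1 => exact labels_J_of_increasing hB hg (by omega) hj hi

lemma labels_last_J (h : Labels (J k) n B) :
    ∃ s, ActiveGaps n B k s ∧ Labels (J k) (n + 1) (insertLeft n B s) := by
  obtain ⟨hB, s, hg, hk, hs, hi, a, b, ha, hab, hBab⟩ := h
  have hsk := hg.1
  simp only [arity] at hsk hg
  refine ⟨s, hg, hB.insertLeft (by omega), s + 1,
    activeGaps_insertLeft_last hB hg ⟨a, b, hBab, by omega⟩, hk, by omega,
    fun y z hyz hz hzn => ?_, shiftLetter s a, shiftLetter s b, ?_,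
    shiftLetter_lt_shiftLetter.2 hab, insertLeft_shift hBab⟩
  · rcases eq_or_ne y s with rfl | hy
    · exact insertLeft_head (by omega) (by omega)
    obtain ⟨y, -, rfl⟩ := exists_shiftLetter (n := n) (v := s) (by omega) (by omega) hy
    obtain ⟨z, -, rfl⟩ := exists_shiftLetter (n := n) (v := s) (a := z) (by omega) (by omega)
      (by omega)
    rw [shiftLetter_lt_shiftLetter] at hyz
    refine insertLeft_shift (hi y z hyz ?_ ?_)
    all_goals unfold shiftLetter at hz hzn; split_ifs at hz hzn <;> omega
  · unfold shiftLetter; rw [if_neg (by omega)]; omega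

lemma labels_child_I (h : Labels (I k) n B) {j : ℕ} (hj : j < k) :
    Labels ((I k).child j) (n + 1) (insertLeft n B (n - j)) := by
  obtain ⟨hB, s, hg, hk, rfl, rfl, hi⟩ := h
  match j with
  | 0 => exact labels_D_top hB hg (by omega)
  | j + 1 => exact labels_J_of_increasing hB hg (by omega) hj fun y z hyz _ hz => hi y z hyz hz

lemma labels_last_I (h : Labels (I k) n B) :
    ∃ s, ActiveGaps n B k s ∧ Labels (I (k + 1)) (n + 1) (insertLeft n B s) := by
  obtain ⟨hB, s, hg, hk, rfl, rfl, hi⟩ := h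
  simp only [arity] at hg
  refine ⟨0, hg, hB.insertLeft (by omega), 0, ⟨by simp [arity], fun g hgn => ?_⟩, by omega, rfl,
    rfl, fun y z hyz hzn => ?_⟩
  · simp only [arity]
    rcases Nat.eq_zero_or_pos g with rfl | hpos
    -- In an increasing word, closing gap 0 would require a descent, so both halves of the split gap
    -- survive and the arity grows.
    · simp only [or_true, iff_true]
      rw [active_insertLeft_of_le hB le_rfl, hg.2 0 (by omega)]
      refine ⟨by omega, ?_⟩
      rintro ⟨x, y, hxy, hc⟩
      exact hB.asymm hxy (hi y x (by omega) (hB.lt_left hxy))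
    · obtain ⟨g, rfl⟩ : ∃ g', g = g' + 1 := ⟨g - 1, by omega⟩
      rw [active_insertLeft_of_lt (by omega), hg.2 g (by omega)]; omega
  · rcases Nat.eq_zero_or_pos y with rfl | hy
    · exact insertLeft_head (by omega) (by omega)
    · have := insertLeft_of_le (n := n) (v := 0) (hi (y - 1) (z - 1) (by omega) (by omega))
        (by omega) (by omega)
      convert this using 1 <;> omega

lemma labels_child {L : Label} (h : Labels L n B) {j : ℕ} (hj : j < L.arity) :
    Labels (L.child j) (n + 1) (insertLeft n B (n - j)) := by
  cases L with
  | c k => exact labels_child_c h hj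
  | D k => exact labels_child_D h hj
  | E k => exact labels_child_E h hj
  | A => exact labels_child_A h hj
  | J k => exact labels_child_J h hj
  | I k => exact labels_child_I h hj

lemma labels_last {L : Label} (h : Labels L n B) :
    ∃ s, ActiveGaps n B L.arity s ∧ Labels L.last (n + 1) (insertLeft n B s) := by
  cases L with
  | c k => exact labels_last_c h
  | D k => exact labels_last_D h
  | E k => exact labels_last_E h
  | A => exact labels_last_A h
  | J k => exact labels_last_J h
  | I k => exact labels_last_I h

end Children

/-! ### Counting permutations by the tree. -/

/-- The number of descendants at depth `d` of a node of the generating tree. -/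
def labelCount : ℕ → Label → ℕ
  | 0, _ => 1
  | d + 1, L => ∑ j ∈ Finset.range L.arity, labelCount d (L.child j) + labelCount d L.last

theorem extensionCount_eq_labelCount (d : ℕ) {L : Label} {n : ℕ} {B : ℕ → ℕ → Prop}
    (h : Labels L n B) : extensionCount d n B = labelCount d L := by
  induction d generalizing L n B with
  | zero => rfl
  | succ d ih =>
    obtain ⟨s, hs, hl⟩ := labels_last h
    rw [extensionCount_succ hs, labelCount, ih hl]
    congr 1
    exact Finset.sum_congr rfl fun j hj => ih (labels_child h (Finset.mem_range.1 hj))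

/-- `a` precedes `b` in the word `σ`. -/
def wordRel {n : ℕ} (σ : Equiv.Perm (Fin n)) (a b : ℕ) : Prop :=
  ∃ i j, i < j ∧ (σ i : ℕ) = a ∧ (σ j : ℕ) = b

lemma isWord_wordRel {n : ℕ} (σ : Equiv.Perm (Fin n)) : IsWord n (wordRel σ) where
  lt_left := by rintro _ _ ⟨i, j, _, rfl, rfl⟩; exact (σ i).2
  lt_right := by rintro _ _ ⟨i, j, _, rfl, rfl⟩; exact (σ j).2
  asymm := by
    rintro _ _ ⟨i, j, hij, rfl, rfl⟩ ⟨k, l, hkl, h1, h2⟩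
    rw [Fin.val_inj, σ.apply_eq_iff_eq] at h1 h2
    subst h1 h2
    exact lt_asymm hij hkl
  total := by
    intro a b ha hb hab
    have hne : σ.symm ⟨a, ha⟩ ≠ σ.symm ⟨b, hb⟩ := fun h => hab (by simpa using h)
    rcases lt_or_gt_of_ne hne with h | h
    · exact Or.inl ⟨_, _, h, by simp, by simp⟩
    · exact Or.inr ⟨_, _, h, by simp, by simp⟩

/-- The word obtained from `σ` by inserting the leftmost letter `v`. -/
def insertPerm {n : ℕ} (v : Fin (n + 1)) (σ : Equiv.Perm (Fin n)) : Equiv.Perm (Fin (n + 1)) :=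
  (finSuccEquiv' 0).trans ((Equiv.optionCongr σ).trans (finSuccEquiv' v).symm)

@[simp] lemma insertPerm_zero {n : ℕ} (v : Fin (n + 1)) (σ : Equiv.Perm (Fin n)) :
    insertPerm v σ 0 = v := by
  simp [insertPerm]

@[simp] lemma insertPerm_succ {n : ℕ} (v : Fin (n + 1)) (σ : Equiv.Perm (Fin n)) (i : Fin n) :
    insertPerm v σ i.succ = v.succAbove (σ i) := by
  have : finSuccEquiv' (0 : Fin (n + 1)) i.succ = some i := by
    rw [← Fin.zero_succAbove, finSuccEquiv'_succAbove]
  simp [insertPerm, this]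

lemma val_insertPerm_succ {n : ℕ} (v : Fin (n + 1)) (σ : Equiv.Perm (Fin n)) (i : Fin n) :
    (insertPerm v σ i.succ : ℕ) = shiftLetter v (σ i) := by
  rw [insertPerm_succ, Fin.succAbove, shiftLetter]
  simp only [Fin.lt_def, Fin.val_castSucc]
  split_ifs <;> simp

lemma wordRel_insertPerm {n : ℕ} (v : Fin (n + 1)) (σ : Equiv.Perm (Fin n)) :
    wordRel (insertPerm v σ) = insertLeft n (wordRel σ) v := by
  funext a b
  refine propext ⟨?_, ?_⟩
  · rintro ⟨i, j, hij, rfl, rfl⟩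
    obtain ⟨j, rfl⟩ := Fin.exists_succ_eq.2 (Fin.ne_zero_of_lt hij)
    rcases Fin.eq_zero_or_eq_succ i with rfl | ⟨i, rfl⟩
    · refine Or.inl ⟨by simp, ?_, Nat.le_of_lt_succ (Fin.is_lt _)⟩
      rw [val_insertPerm_succ]; exact shiftLetter_ne _ _
    · exact Or.inr ⟨_, _, ⟨i, j, Fin.succ_lt_succ_iff.1 hij, rfl, rfl⟩,
        val_insertPerm_succ .., val_insertPerm_succ ..⟩
  · rintro (⟨rfl, hb, hbn⟩ | ⟨_, _, ⟨i, j, hij, rfl, rfl⟩, rfl, rfl⟩)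
    · obtain ⟨x, hx, rfl⟩ := exists_shiftLetter (Nat.le_of_lt_succ v.2) (Nat.lt_succ_of_le hbn) hb
      refine ⟨0, (σ.symm ⟨x, hx⟩).succ, Fin.succ_pos _, by simp, ?_⟩
      rw [val_insertPerm_succ]; simp
    · exact ⟨i.succ, j.succ, Fin.succ_lt_succ_iff.2 hij, val_insertPerm_succ ..,
        val_insertPerm_succ ..⟩

lemma bijective_insertPerm (n : ℕ) :
    Function.Bijective fun p : Fin (n + 1) × Equiv.Perm (Fin n) => insertPerm p.1 p.2 := by
  rw [Fintype.bijective_iff_injective_and_card]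
  constructor
  · rintro ⟨v, σ⟩ ⟨v', σ'⟩ h
    have h0 : v = v' := by simpa using congrArg (fun τ : Equiv.Perm (Fin (n + 1)) => τ 0) h
    subst h0
    have : σ = σ' := Equiv.ext fun i => by
      simpa using congrArg (fun τ : Equiv.Perm (Fin (n + 1)) => τ i.succ) h
    rw [this]
  · simp [Fintype.card_perm, Nat.factorial_succ]

/-- The three patterns of length four. -/
abbrev triplePatterns : Set (Fin 4 → ℕ) := {![1, 3, 2, 4], ![2, 3, 4, 1], ![1, 2, 4, 3]}

/-- The word `a b c d` is an occurrence of one of the three patterns. -/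
def Occurs (a b c d : ℕ) : Prop :=
  (a < c ∧ c < b ∧ b < d) ∨ (a < b ∧ b < d ∧ d < c) ∨ (d < a ∧ a < b ∧ b < c)

lemma containsPattern_four_iff {n : ℕ} {w : Fin n → Fin n} {p : Fin 4 → ℕ} :
    ContainsPattern w p ↔ ∃ i j k l, i < j ∧ j < k ∧ k < l ∧
      ∀ x y, w (![i, j, k, l] x) < w (![i, j, k, l] y) ↔ p x < p y := by
  constructor
  · rintro ⟨f, hf, h⟩
    refine ⟨f 0, f 1, f 2, f 3, hf (by decide), hf (by decide), hf (by decide), ?_⟩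
    have : ![f 0, f 1, f 2, f 3] = f := by funext x; fin_cases x <;> rfl
    rwa [this]
  · rintro ⟨i, j, k, l, hij, hjk, hkl, h⟩
    refine ⟨_, ?_, h⟩
    rw [Fin.strictMono_iff_lt_succ]
    intro x
    fin_cases x
    exacts [hij, hjk, hkl]

lemma mem_avoiders_triplePatterns {n : ℕ} {σ : Equiv.Perm (Fin n)} :
    σ ∈ avoiders triplePatterns n ↔
      ∀ i j k l, i < j → j < k → k < l → ¬ Occurs (σ i) (σ j) (σ k) (σ l) := by
  simp only [avoiders, triplePatterns, Set.mem_ofPred_eq, Set.mem_insert_iff,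
    Set.mem_singleton_iff, forall_eq_or_imp, forall_eq, containsPattern_four_iff]
  constructor
  · rintro ⟨h1, h2, h3⟩ i j k l hij hjk hkl (h | h | h)
    · refine h1 ⟨i, j, k, l, hij, hjk, hkl, fun x y => ?_⟩
      fin_cases x <;> fin_cases y <;> simp [-Fin.val_fin_lt, Fin.lt_def] <;> omega
    · refine h3 ⟨i, j, k, l, hij, hjk, hkl, fun x y => ?_⟩
      fin_cases x <;> fin_cases y <;> simp [-Fin.val_fin_lt, Fin.lt_def] <;> omega
    · refine h2 ⟨i, j, k, l, hij, hjk, hkl, fun x y => ?_⟩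
      fin_cases x <;> fin_cases y <;> simp [-Fin.val_fin_lt, Fin.lt_def] <;> omega
  · intro H
    refine ⟨?_, ?_, ?_⟩
    · rintro ⟨i, j, k, l, hij, hjk, hkl, h⟩
      exact H i j k l hij hjk hkl
        (Or.inl ⟨(h 0 2).2 (by simp), (h 2 1).2 (by simp), (h 1 3).2 (by simp)⟩)
    · rintro ⟨i, j, k, l, hij, hjk, hkl, h⟩
      exact H i j k l hij hjk hkl
        (Or.inr (Or.inr ⟨(h 3 0).2 (by simp), (h 0 1).2 (by simp), (h 1 2).2 (by simp)⟩))
    · rintro ⟨i, j, k, l, hij, hjk, hkl, h⟩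
      exact H i j k l hij hjk hkl
        (Or.inr (Or.inl ⟨(h 0 1).2 (by simp), (h 1 3).2 (by simp), (h 3 2).2 (by simp)⟩))

lemma occurs_shiftLetter {v a b c d : ℕ} :
    Occurs (shiftLetter v a) (shiftLetter v b) (shiftLetter v c) (shiftLetter v d) ↔
      Occurs a b c d := by
  simp only [Occurs, shiftLetter_lt_shiftLetter]

lemma occurs_head {v a b c : ℕ} :
    Occurs v (shiftLetter v a) (shiftLetter v b) (shiftLetter v c) ↔
      (v ≤ b ∧ b < a ∧ a < c) ∨ (v ≤ a ∧ a < c ∧ c < b) ∨ (c < v ∧ v ≤ a ∧ a < b) := by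
  have h1 : ∀ x, v < shiftLetter v x ↔ v ≤ x := fun x => by
    unfold shiftLetter; split_ifs <;> omega
  have h2 : ∀ x, shiftLetter v x < v ↔ x < v := fun x => by
    unfold shiftLetter; split_ifs <;> omega
  simp only [Occurs, shiftLetter_lt_shiftLetter, h1, h2]

lemma insertPerm_mem_avoiders {n : ℕ} {v : Fin (n + 1)} {σ : Equiv.Perm (Fin n)} :
    insertPerm v σ ∈ avoiders triplePatterns (n + 1) ↔
      σ ∈ avoiders triplePatterns n ∧ Active (wordRel σ) v := by
  simp only [mem_avoiders_triplePatterns]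
  constructor
  · refine fun H => ⟨fun i j k l hij hjk hkl h => ?_, ?_⟩
    · refine H i.succ j.succ k.succ l.succ (Fin.succ_lt_succ_iff.2 hij)
        (Fin.succ_lt_succ_iff.2 hjk) (Fin.succ_lt_succ_iff.2 hkl) ?_
      simpa only [val_insertPerm_succ, occurs_shiftLetter] using h
    · rintro _ _ _ ⟨j, k, hjk, rfl, rfl⟩ ⟨k', l, hkl, hk, rfl⟩
      rw [Fin.val_inj, σ.apply_eq_iff_eq] at hk
      subst hk
      have := H 0 j.succ k'.succ l.succ (Fin.succ_pos _) (Fin.succ_lt_succ_iff.2 hjk)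
        (Fin.succ_lt_succ_iff.2 hkl)
      simp only [val_insertPerm_succ, insertPerm_zero, occurs_head] at this
      tauto
  · rintro ⟨H, K⟩ i j k l hij hjk hkl h
    obtain ⟨j, rfl⟩ := Fin.exists_succ_eq.2 (Fin.ne_zero_of_lt hij)
    obtain ⟨k, rfl⟩ := Fin.exists_succ_eq.2 (Fin.ne_zero_of_lt hjk)
    obtain ⟨l, rfl⟩ := Fin.exists_succ_eq.2 (Fin.ne_zero_of_lt hkl)
    rw [Fin.succ_lt_succ_iff] at hjk hkl
    rcases Fin.eq_zero_or_eq_succ i with rfl | ⟨i, rfl⟩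
    · simp only [val_insertPerm_succ, insertPerm_zero, occurs_head] at h
      have := K _ _ _ ⟨j, k, hjk, rfl, rfl⟩ ⟨k, l, hkl, rfl, rfl⟩
      tauto
    · rw [Fin.succ_lt_succ_iff] at hij
      simp only [val_insertPerm_succ, occurs_shiftLetter] at h
      exact H i j k l hij hjk hkl h

open Classical in
-- Avoiders of length `n + 1` are grouped by the word left after deleting the first letter.
lemma sum_extensionCount (n d : ℕ) :
    (∑ σ : Equiv.Perm (Fin (n + 1)), if σ ∈ avoiders triplePatterns (n + 1) then
        extensionCount d (n + 1) (wordRel σ) else 0) =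
      ∑ σ : Equiv.Perm (Fin n), if σ ∈ avoiders triplePatterns n then
        extensionCount (d + 1) n (wordRel σ) else 0 := by
  rw [← (bijective_insertPerm n).sum_comp, Fintype.sum_prod_type_right]
  refine Finset.sum_congr rfl fun σ _ => ?_
  simp only [insertPerm_mem_avoiders, wordRel_insertPerm]
  by_cases h : σ ∈ avoiders triplePatterns n
  · simp only [h, true_and, if_true, extensionCount]
    exact Fin.sum_univ_eq_sum_range
      (fun g => if Active (wordRel σ) g then
        extensionCount d (n + 1) (insertLeft n (wordRel σ) g) else 0) (n + 1)
  · simp [h]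

open Classical in
lemma ncard_avoiders_eq_sum (n d : ℕ) :
    (avoiders triplePatterns (n + d)).ncard =
      ∑ σ : Equiv.Perm (Fin n), if σ ∈ avoiders triplePatterns n then
        extensionCount d n (wordRel σ) else 0 := by
  induction d generalizing n with
  | zero =>
    simp only [extensionCount, Finset.sum_boole, Nat.cast_id]
    rw [← Set.ncard_coe_finset]
    congr 1
    ext; simp
  | succ d ih => rw [← sum_extensionCount, ← ih, add_right_comm, add_assoc]

/-- Root of the tree: with a single letter no pair is related, so both gaps, 1 and `s = 0`, are
active. -/
lemma labels_one (σ : Equiv.Perm (Fin 1)) : Labels (.I 1) 1 (wordRel σ) := by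
  have h : ∀ a b, ¬ wordRel σ a b := by
    rintro a b ⟨i, j, hij, -⟩
    exact hij.ne (Subsingleton.elim _ _)
  refine ⟨isWord_wordRel σ, 0, ⟨le_rfl, fun g hg => ?_⟩, le_rfl, rfl, rfl, fun y z _ _ => by omega⟩
  exact ⟨fun _ => by simp only [Label.arity]; omega, fun _ a b c hab => absurd hab (h a b)⟩

lemma ncard_avoiders_succ (n : ℕ) :
    (avoiders triplePatterns (n + 1)).ncard = labelCount n (.I 1) := by
  classical
  rw [add_comm, ncard_avoiders_eq_sum, Fintype.sum_unique, if_pos]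
  · exact extensionCount_eq_labelCount n (labels_one _)
  rw [mem_avoiders_triplePatterns]
  intro i j k l hij
  exact absurd (Subsingleton.elim i j) hij.ne

lemma ncard_avoiders_zero : (avoiders triplePatterns 0).ncard = 1 := by
  have : avoiders triplePatterns 0 = Set.univ :=
    Set.eq_univ_of_forall fun σ => mem_avoiders_triplePatterns.2 fun i => i.elim0
  rw [this, Set.ncard_univ, Nat.card_eq_fintype_card, Fintype.card_unique]

/-! ### Functional equations and their solutions. -/

open PowerSeries in
lemma catalanGF_eq : catalanGF = 1 + X * catalanGF ^ 2 := by
  have h : catalanGF = catalanSeries.map (Nat.castRingHom ℚ) := by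
    ext n; simp [catalanGF]
  have := congrArg (PowerSeries.map (Nat.castRingHom ℚ)) catalanSeries_sq_mul_X_add_one
  rw [map_add, map_mul, map_pow, map_one, map_X, ← h] at this
  linear_combination -this

/-- The generating function of the numbers of descendants of a node. -/
noncomputable def labelGF (L : Label) : ℚ⟦X⟧ := PowerSeries.mk fun d => (labelCount d L : ℚ)

section LabelGF

open PowerSeries Label Finset

lemma labelGF_eq (L : Label) :
    labelGF L = 1 + X * (∑ j ∈ range L.arity, labelGF (L.child j) + labelGF L.last) := by
  ext d
  cases d with
  | zero => simp [labelGF, labelCount]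
  | succ d =>
    rw [map_add, coeff_succ_X_mul, map_add, map_sum]
    simp [labelGF, labelCount, coeff_one]

lemma catalanGF_pow_eq (m : ℕ) : catalanGF ^ (m + 2) =
    1 + X * (∑ j ∈ range m, catalanGF ^ (j + 2) + catalanGF ^ (m + 3) + catalanGF ^ (m + 2)) := by
  have h := catalanGF_eq
  induction m with
  | zero => simp only [range_zero, sum_empty]; linear_combination (catalanGF + 1) * h
  | succ m ih =>
    rw [sum_range_succ]
    linear_combination ih + catalanGF ^ (m + 2) * h

lemma labelGF_c_eq (m : ℕ) : labelGF (c (m + 1)) = 1 + X * (∑ j ∈ range m, labelGF (c (j + 1)) +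
    labelGF (c (m + 2)) + labelGF (c (m + 1))) := by
  exact (labelGF_eq _).trans (by simp only [arity, sum_range_succ', child, last, add_assoc])

/-- Both sides satisfy the same system, in which the factor X makes each coefficient depend only on
coefficients of lower degree. -/
lemma labelGF_c (m : ℕ) : labelGF (c (m + 1)) = catalanGF ^ (m + 2) := by
  ext d
  induction d generalizing m with
  | zero => rw [labelGF_c_eq, catalanGF_pow_eq]; simp
  | succ d ih =>
    rw [labelGF_c_eq, catalanGF_pow_eq]
    simp only [map_add, coeff_succ_X_mul, map_sum, ih]

lemma X_mul_sum_catalanGF_pow (m : ℕ) :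
    X * ∑ j ∈ range m, catalanGF ^ (j + 3) = catalanGF ^ (m + 1) - catalanGF := by
  induction m with
  | zero => simp
  | succ m ih =>
    rw [sum_range_succ]
    linear_combination ih - catalanGF ^ (m + 1) * catalanGF_eq

lemma labelGF_E (m : ℕ) : (1 - X) * labelGF (E (m + 2)) =
    1 - 2 * catalanGF + catalanGF ^ 2 + catalanGF ^ (m + 1) - catalanGF ^ (m + 2) +
      catalanGF ^ (m + 3) := by
  have h := labelGF_eq (E (m + 2))
  simp only [arity, sum_range_succ', child, last, labelGF_c] at h
  linear_combination h + X_mul_sum_catalanGF_pow m -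
    (catalanGF ^ (m + 2) + catalanGF) * catalanGF_eq

lemma labelGF_A : labelGF A = X * labelGF (D 3) + catalanGF ^ 2 := by
  have h := labelGF_eq A
  have h1 := labelGF_c 0
  have h2 := labelGF_c 1
  simp only [arity, sum_range_succ', range_zero, sum_empty, child, last, zero_add] at h h1 h2
  rw [h1, h2] at h
  linear_combination h - (catalanGF + 1) * catalanGF_eq

lemma labelGF_D (m : ℕ) : labelGF (D (m + 2)) - X * labelGF (D (m + 3)) =
    1 + X * labelGF A + catalanGF ^ (m + 1) - catalanGF + X * labelGF (E (m + 2)) := by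
  have h := labelGF_eq (D (m + 2))
  simp only [arity, sum_range_succ', child, last, labelGF_c] at h
  linear_combination h + X_mul_sum_catalanGF_pow m

lemma labelGF_J (m : ℕ) : labelGF (J (m + 2)) = 1 + X * (catalanGF ^ (m + 4) +
    ∑ j ∈ range (m + 1), labelGF (J (j + 2)) + labelGF (J (m + 2))) := by
  have h := labelGF_eq (J (m + 2))
  simp only [arity, sum_range_succ' _ (m + 1), child, last, labelGF_c] at h
  linear_combination h

/-- Differencing consecutive equations removes the sum and leaves a first-order recurrence. -/
lemma labelGF_J_succ (m : ℕ) : (1 - 2 * X) * labelGF (J (m + 3)) =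
    (1 - X) * labelGF (J (m + 2)) + X * (catalanGF ^ (m + 5) - catalanGF ^ (m + 4)) := by
  have h := labelGF_J (m + 1)
  rw [sum_range_succ] at h
  linear_combination h - labelGF_J m

lemma labelGF_J_two : (1 - 2 * X) * labelGF (J 2) = 1 + X * catalanGF ^ 4 := by
  have h := labelGF_J 0
  simp only [zero_add, sum_range_one] at h
  linear_combination h

lemma labelGF_I_one : labelGF (I 1) = 1 + X * (labelGF (D 2) + labelGF (I 2)) := by
  have h := labelGF_eq (I 1)
  simpa only [arity, sum_range_one, child, last] using h

lemma labelGF_I (m : ℕ) : labelGF (I (m + 2)) - X * labelGF (I (m + 3)) =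
    X * labelGF (D (m + 3)) + (1 - X) * labelGF (J (m + 2)) - X * catalanGF ^ (m + 4) := by
  have h := labelGF_eq (I (m + 2))
  simp only [arity, sum_range_succ' _ (m + 1), child, last] at h
  linear_combination h - labelGF_J m

/-- Each `u m` is divisible by every power of X. This gives uniqueness for the recurrences of `D`
and `I`, which express a term through the next one: checking a proposed solution suffices. -/
lemma eq_zero_of_eq_X_mul {u : ℕ → ℚ⟦X⟧} (h : ∀ m, u m = X * u (m + 1)) (m : ℕ) : u m = 0 := by
  have h' : ∀ k, u m = X ^ k * u (m + k) := fun k => by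
    induction k with
    | zero => simp
    | succ k ih => rw [ih, h (m + k)]; ring_nf
  ext n
  rw [h' (n + 1), coeff_X_pow_mul']
  simp

lemma labelGF_D_solution (m : ℕ) : (1 - X) ^ 2 * (labelGF (D (m + 2)) - catalanGF ^ (m + 3)) =
    (1 + X * labelGF A - catalanGF) * (1 - X) + X - 2 * X * catalanGF + catalanGF - 1 := by
  refine sub_eq_zero.1 (eq_zero_of_eq_X_mul (u := fun m => (1 - X) ^ 2 *
    (labelGF (D (m + 2)) - catalanGF ^ (m + 3)) - ((1 + X * labelGF A - catalanGF) * (1 - X) + X -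
      2 * X * catalanGF + catalanGF - 1)) (fun m => ?_) m)
  have h := catalanGF_eq
  linear_combination (1 - X) ^ 2 * labelGF_D m + (1 - X) * X * labelGF_E m -
    (1 - X) * (1 + catalanGF ^ (m + 1) * (1 + (1 - X) * catalanGF)) * h

lemma one_sub_two_X_ne_zero : (1 - 2 * X : ℚ⟦X⟧) ≠ 0 := fun h => by
  simpa using congrArg constantCoeff h

/-- A particular solution proportional to C^m plus a multiple of the homogeneous solution ((1 -
X)/(1 - 2X))^m; the prefactor clears the denominator of the former. -/
lemma labelGF_J_solution (m : ℕ) :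
    ((1 - 2 * X) * catalanGF - (1 - X)) * labelGF (J (m + 2)) =
      X * (catalanGF ^ 3 - catalanGF ^ 2) * catalanGF ^ (m + 2) +
      (((1 - 2 * X) * catalanGF - (1 - X)) * labelGF (J 2) -
        X * (catalanGF ^ 3 - catalanGF ^ 2) * catalanGF ^ 2) *
        ((1 - X) * (1 - 2 * X)⁻¹) ^ m := by
  induction m with
  | zero => ring
  | succ m ih =>
    have hq : (1 - 2 * X : ℚ⟦X⟧) * (1 - 2 * X)⁻¹ = 1 := PowerSeries.mul_inv_cancel _ (by simp)
    refine mul_left_cancel₀ one_sub_two_X_ne_zero ?_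
    rw [pow_succ ((1 - X) * (1 - 2 * X)⁻¹ : ℚ⟦X⟧) m]
    generalize ((1 - X) * (1 - 2 * X)⁻¹ : ℚ⟦X⟧) ^ m = r at ih ⊢
    linear_combination ((1 - 2 * X) * catalanGF - (1 - X)) * labelGF_J_succ m + (1 - X) * ih -
      (1 - X) * r * (((1 - 2 * X) * catalanGF - (1 - X)) * labelGF (J 2) -
        X * (catalanGF ^ 3 - catalanGF ^ 2) * catalanGF ^ 2) * hq

/-- The forcing is a sum of terms proportional to 1, C^m and r^m with r = (1 - X)/(1 - 2X).
Inverting u ↦ u m - X u (m + 1) divides them by 1 - X, by 1 - XC = 1/C, and by 1 - Xr = (1 - 3X +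
X²)/(1 - 2X). -/
lemma labelGF_I_solution (m : ℕ) :
    (1 - X) ^ 3 * (1 - 3 * X + X ^ 2) * ((1 - 2 * X) * catalanGF - (1 - X)) *
        labelGF (I (m + 2)) =
      X * ((1 + X * labelGF A - catalanGF) * (1 - X) + X - 2 * X * catalanGF + catalanGF - 1) *
        (1 - 3 * X + X ^ 2) * ((1 - 2 * X) * catalanGF - (1 - X)) +
      (1 - X) ^ 4 * ((1 - 3 * X + X ^ 2) * (X * (catalanGF ^ 3 - catalanGF ^ 2)) *
          catalanGF ^ (m + 3) +
        (((1 - 2 * X) * catalanGF - (1 - X)) * labelGF (J 2) -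
          X * (catalanGF ^ 3 - catalanGF ^ 2) * catalanGF ^ 2) * (1 - 2 * X) *
          ((1 - X) * (1 - 2 * X)⁻¹) ^ m) := by
  refine sub_eq_zero.1 (eq_zero_of_eq_X_mul (u := fun m =>
    (1 - X) ^ 3 * (1 - 3 * X + X ^ 2) * ((1 - 2 * X) * catalanGF - (1 - X)) *
        labelGF (I (m + 2)) -
      (X * ((1 + X * labelGF A - catalanGF) * (1 - X) + X - 2 * X * catalanGF + catalanGF - 1) *
        (1 - 3 * X + X ^ 2) * ((1 - 2 * X) * catalanGF - (1 - X)) +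
      (1 - X) ^ 4 * ((1 - 3 * X + X ^ 2) * (X * (catalanGF ^ 3 - catalanGF ^ 2)) *
          catalanGF ^ (m + 3) +
        (((1 - 2 * X) * catalanGF - (1 - X)) * labelGF (J 2) -
          X * (catalanGF ^ 3 - catalanGF ^ 2) * catalanGF ^ 2) * (1 - 2 * X) *
          ((1 - X) * (1 - 2 * X)⁻¹) ^ m))) (fun m => ?_) m)
  have hq : (1 - 2 * X : ℚ⟦X⟧) * (1 - 2 * X)⁻¹ = 1 := PowerSeries.mul_inv_cancel _ (by simp)
  have hJ := labelGF_J_solution m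
  have hD := labelGF_D_solution (m + 1)
  have hI := labelGF_I m
  have h := catalanGF_eq
  simp only [pow_succ ((1 - X) * (1 - 2 * X)⁻¹ : ℚ⟦X⟧) m]
  generalize ((1 - X) * (1 - 2 * X)⁻¹ : ℚ⟦X⟧) ^ m = r at hJ ⊢
  generalize (1 - 2 * X : ℚ⟦X⟧)⁻¹ = i at hq ⊢
  linear_combination
    (1 - X) ^ 3 * (1 - 3 * X + X ^ 2) * ((1 - 2 * X) * catalanGF - (1 - X)) * hI +
    (1 - X) * X * (1 - 3 * X + X ^ 2) * ((1 - 2 * X) * catalanGF - (1 - X)) * hD +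
    (1 - X) ^ 4 * (1 - 3 * X + X ^ 2) * hJ -
    (1 - X) ^ 4 * (1 - 3 * X + X ^ 2) * (X * (catalanGF ^ 3 - catalanGF ^ 2)) *
      catalanGF ^ (m + 2) * h +
    (1 - X) ^ 5 * X * r * (((1 - 2 * X) * catalanGF - (1 - X)) * labelGF (J 2) -
      X * (catalanGF ^ 3 - catalanGF ^ 2) * catalanGF ^ 2) * hq

end LabelGF

/-! ### Elimination in a field, then in a domain. -/

/-- Elimination of the auxiliary unknowns from the functional equations. -/
lemma series_elimination_field {K : Type*} [Field K] {x C A D₂ D₃ J₂ I₁ I₂ F : K} (hx : x ≠ 0)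
    (hC : C = 1 + x * C ^ 2) (hC0 : C ≠ 0) (h1 : 1 - x ≠ 0) (h2 : 1 - 2 * x ≠ 0)
    (h3 : 1 - 3 * x + x ^ 2 ≠ 0) (h4 : 1 - x - x ^ 2 ≠ 0)
    (hA : A = x * D₃ + C ^ 2) (hJ : (1 - 2 * x) * J₂ = 1 + x * C ^ 4)
    (hD₂ : (1 - x) ^ 2 * (D₂ - C ^ 3) = (1 + x * A - C) * (1 - x) + x - 2 * x * C + C - 1)
    (hD₃ : (1 - x) ^ 2 * (D₃ - C ^ 4) = (1 + x * A - C) * (1 - x) + x - 2 * x * C + C - 1)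
    (hI₂ : (1 - x) ^ 3 * (1 - 3 * x + x ^ 2) * ((1 - 2 * x) * C - (1 - x)) * I₂ =
      x * ((1 + x * A - C) * (1 - x) + x - 2 * x * C + C - 1) *
        (1 - 3 * x + x ^ 2) * ((1 - 2 * x) * C - (1 - x)) +
      (1 - x) ^ 4 * ((1 - 3 * x + x ^ 2) * (x * (C ^ 3 - C ^ 2)) * C ^ 3 +
        (((1 - 2 * x) * C - (1 - x)) * J₂ - x * (C ^ 3 - C ^ 2) * C ^ 2) * (1 - 2 * x)))
    (hI₁ : I₁ = 1 + x * (D₂ + I₂)) (hF : F = 1 + x * I₁) :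
    F * (x * (1 - x) ^ 2 * (1 - 3 * x + x ^ 2) * (1 - x - x ^ 2)) =
      (1 - 7 * x + 19 * x ^ 2 - 25 * x ^ 3 + 13 * x ^ 4 + 4 * x ^ 5 - 5 * x ^ 6 + x ^ 7) * C -
        1 + 7 * x - 19 * x ^ 2 + 23 * x ^ 3 - 7 * x ^ 4 - 7 * x ^ 5 + 4 * x ^ 6 := by
  -- The Catalan equation is linear in `x`, so C becomes the only parameter and all unknowns are
  -- rational in it.
  obtain rfl : x = (C - 1) / C ^ 2 := by field_simp; linear_combination -hC
  have hC1 : C - 1 ≠ 0 := fun h => hx (by rw [h, zero_div])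
  have e1 : 1 - (C - 1) / C ^ 2 = (C ^ 2 - C + 1) / C ^ 2 := by field_simp; ring
  have e2 : 1 - 2 * ((C - 1) / C ^ 2) = (C ^ 2 - 2 * C + 2) / C ^ 2 := by field_simp; ring
  have e3 : 1 - 3 * ((C - 1) / C ^ 2) + ((C - 1) / C ^ 2) ^ 2 =
      (C ^ 4 - 3 * C ^ 3 + 4 * C ^ 2 - 2 * C + 1) / C ^ 4 := by field_simp; ring
  have e4 : 1 - (C - 1) / C ^ 2 - ((C - 1) / C ^ 2) ^ 2 =
      (C ^ 4 - C ^ 3 + 2 * C - 1) / C ^ 4 := by field_simp; ring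
  -- The prefactor from the `J` recurrence is nonzero because C ≠ 1, so it can be cancelled.
  have e5 : (C ^ 2 - 2 * C + 2) / C ^ 2 * C - (C ^ 2 - C + 1) / C ^ 2 = (C - 1) ^ 3 / C ^ 2 := by
    field_simp; ring
  rw [e3] at h3 hI₂ ⊢
  rw [e4] at h4 ⊢
  rw [e1] at h1 hD₂ hD₃ hI₂ ⊢
  rw [e2] at h2 hJ hI₂
  rw [e5] at hI₂
  have ha : C ^ 2 - C + 1 ≠ 0 := fun h => h1 (by rw [h, zero_div])
  have hb : C ^ 2 - 2 * C + 2 ≠ 0 := fun h => h2 (by rw [h, zero_div])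
  have hp : C ^ 4 - 3 * C ^ 3 + 4 * C ^ 2 - 2 * C + 1 ≠ 0 := fun h => h3 (by rw [h, zero_div])
  have hs : C ^ 4 - C ^ 3 + 2 * C - 1 ≠ 0 := fun h => h4 (by rw [h, zero_div])
  clear e1 e2 e3 e4 e5 h1 h2 h3 h4 hC hx
  -- The denominators become opaque nonzero atoms while fractions are cleared, and are expanded
  -- again for the polynomial identities.
  generalize hae : C ^ 2 - C + 1 = a at *
  generalize hbe : C ^ 2 - 2 * C + 2 = b at *
  generalize hpe : C ^ 4 - 3 * C ^ 3 + 4 * C ^ 2 - 2 * C + 1 = p at *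
  generalize hse : C ^ 4 - C ^ 3 + 2 * C - 1 = s at *
  -- `A` and `D₃` determine each other; solving this pair produces the factor 1 - x - x², here `s /
  -- C ^ 4`.
  have hD₃' : D₃ = C ^ 4 + (C - 1) ^ 2 * C ^ 6 /
      (a * s) := by
    rw [hA] at hD₃
    field_simp at hD₃ ⊢
    subst hae hse
    linear_combination hD₃
  have hD₂' : D₂ = C ^ 3 + (C - 1) ^ 2 * C ^ 6 /
      (a * s) := by
    have h := mul_left_cancel₀ (pow_ne_zero 2 (div_ne_zero ha (pow_ne_zero 2 hC0)))
      (hD₂.trans hD₃.symm)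
    linear_combination h + hD₃'
  have hJ' : J₂ = (1 + (C - 1) * C ^ 2) * C ^ 2 / b := by
    field_simp at hJ ⊢
    linear_combination hJ
  have hI₂' : I₂ = (C - 1) * ((C - 1) ^ 2 * C ^ 6 /
      (a * s)) / a +
      a * (C ^ 4 - 2 * C ^ 3 + 2 * C ^ 2 - C + 1) * C ^ 2 /
        p := by
    rw [← hD₃, hD₃', hJ'] at hI₂
    refine mul_left_cancel₀ (mul_ne_zero (mul_ne_zero (pow_ne_zero 3 (div_ne_zero ha
      (pow_ne_zero 2 hC0))) (div_ne_zero hp (pow_ne_zero 4 hC0)))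
      (div_ne_zero (pow_ne_zero 3 hC1) (pow_ne_zero 2 hC0))) (hI₂.trans ?_)
    field_simp
    subst hae hbe hpe hse
    ring
  rw [hF, hI₁, hI₂', hD₂']
  field_simp
  subst hae hpe hse
  ring

/-- Elimination of the auxiliary unknowns from the functional equations, in a domain. -/
lemma series_elimination {R : Type*} [CommRing R] [IsDomain R] {x C A D₂ D₃ J₂ I₁ I₂ F : R}
    (hx : x ≠ 0)
    (hC : C = 1 + x * C ^ 2) (hC0 : C ≠ 0) (h1 : 1 - x ≠ 0) (h2 : 1 - 2 * x ≠ 0)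
    (h3 : 1 - 3 * x + x ^ 2 ≠ 0) (h4 : 1 - x - x ^ 2 ≠ 0)
    (hA : A = x * D₃ + C ^ 2) (hJ : (1 - 2 * x) * J₂ = 1 + x * C ^ 4)
    (hD₂ : (1 - x) ^ 2 * (D₂ - C ^ 3) = (1 + x * A - C) * (1 - x) + x - 2 * x * C + C - 1)
    (hD₃ : (1 - x) ^ 2 * (D₃ - C ^ 4) = (1 + x * A - C) * (1 - x) + x - 2 * x * C + C - 1)
    (hI₂ : (1 - x) ^ 3 * (1 - 3 * x + x ^ 2) * ((1 - 2 * x) * C - (1 - x)) * I₂ =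
      x * ((1 + x * A - C) * (1 - x) + x - 2 * x * C + C - 1) *
        (1 - 3 * x + x ^ 2) * ((1 - 2 * x) * C - (1 - x)) +
      (1 - x) ^ 4 * ((1 - 3 * x + x ^ 2) * (x * (C ^ 3 - C ^ 2)) * C ^ 3 +
        (((1 - 2 * x) * C - (1 - x)) * J₂ - x * (C ^ 3 - C ^ 2) * C ^ 2) * (1 - 2 * x)))
    (hI₁ : I₁ = 1 + x * (D₂ + I₂)) (hF : F = 1 + x * I₁) :
    F * (x * (1 - x) ^ 2 * (1 - 3 * x + x ^ 2) * (1 - x - x ^ 2)) =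
      (1 - 7 * x + 19 * x ^ 2 - 25 * x ^ 3 + 13 * x ^ 4 + 4 * x ^ 5 - 5 * x ^ 6 + x ^ 7) * C -
        1 + 7 * x - 19 * x ^ 2 + 23 * x ^ 3 - 7 * x ^ 4 - 7 * x ^ 5 + 4 * x ^ 6 := by
  let φ := algebraMap R (FractionRing R)
  have hφ : Function.Injective φ := IsFractionRing.injective R (FractionRing R)
  have h0 : ∀ f : R, f ≠ 0 → φ f ≠ 0 := fun f => (map_ne_zero_iff φ hφ).2
  apply hφ
  have := series_elimination_field (h0 _ hx) (by simpa using congrArg φ hC) (h0 _ hC0)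
    (by simpa only [map_add, map_sub, map_mul, map_pow, map_one, map_ofNat] using h0 _ h1)
    (by simpa only [map_add, map_sub, map_mul, map_pow, map_one, map_ofNat] using h0 _ h2)
    (by simpa only [map_add, map_sub, map_mul, map_pow, map_one, map_ofNat] using h0 _ h3)
    (by simpa only [map_add, map_sub, map_mul, map_pow, map_one, map_ofNat] using h0 _ h4)
    (by simpa only [map_add, map_sub, map_mul, map_pow, map_one, map_ofNat] using congrArg φ hA)
    (by simpa only [map_add, map_sub, map_mul, map_pow, map_one, map_ofNat] using congrArg φ hJ)
    (by simpa only [map_add, map_sub, map_mul, map_pow, map_one, map_ofNat] using congrArg φ hD₂)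
    (by simpa only [map_add, map_sub, map_mul, map_pow, map_one, map_ofNat] using congrArg φ hD₃)
    (by simpa only [map_add, map_sub, map_mul, map_pow, map_one, map_ofNat] using congrArg φ hI₂)
    (by simpa only [map_add, map_sub, map_mul, map_pow, map_one, map_ofNat] using congrArg φ hI₁)
    (by simpa only [map_add, map_sub, map_mul, map_pow, map_one, map_ofNat] using congrArg φ hF)
  simpa only [map_add, map_sub, map_mul, map_pow, map_one, map_ofNat] using this

/-! ### Assembly of the generating function. -/

section Series

open PowerSeries Label

lemma avoiderSeries_eq : avoiderSeries triplePatterns = 1 + X * labelGF (I 1) := by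
  ext n
  cases n with
  | zero => simp [avoiderSeries, ncard_avoiders_zero]
  | succ n => simp [avoiderSeries, labelGF, ncard_avoiders_succ, coeff_one, coeff_succ_X_mul]

lemma avoiderSeries_mul :
    avoiderSeries triplePatterns *
        (X * (1 - X) ^ 2 * (1 - 3 * X + X ^ 2) * (1 - X - X ^ 2)) =
      (1 - 7 * X + 19 * X ^ 2 - 25 * X ^ 3 + 13 * X ^ 4 + 4 * X ^ 5 - 5 * X ^ 6 + X ^ 7) *
          catalanGF - 1 + 7 * X - 19 * X ^ 2 + 23 * X ^ 3 - 7 * X ^ 4 - 7 * X ^ 5 + 4 * X ^ 6 := by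
  have h0 : ∀ f : ℚ⟦X⟧, constantCoeff f ≠ 0 → f ≠ 0 := fun f hf h => hf (by rw [h, map_zero])
  have hI := labelGF_I_solution 0
  rw [pow_zero, mul_one] at hI
  exact series_elimination X_ne_zero catalanGF_eq (h0 _ (by simp [catalanGF])) (h0 _ (by simp))
    one_sub_two_X_ne_zero (h0 _ (by simp)) (h0 _ (by simp)) labelGF_A labelGF_J_two
    (labelGF_D_solution 0) (labelGF_D_solution 1) hI labelGF_I_one avoiderSeries_eq

end Series

/-- The quotient is taken in the field of formal Laurent series over `ℚ`. -/
theorem mainTheorem2 :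
    ((avoiderSeries {![1, 3, 2, 4], ![2, 3, 4, 1], ![1, 2, 4, 3]} : ℚ⟦X⟧) : ℚ⸨X⸩) =
      (((1 - 7 * PowerSeries.X + 19 * PowerSeries.X ^ 2 - 25 * PowerSeries.X ^ 3
            + 13 * PowerSeries.X ^ 4 + 4 * PowerSeries.X ^ 5 - 5 * PowerSeries.X ^ 6
            + PowerSeries.X ^ 7) * catalanGF
          - 1 + 7 * PowerSeries.X - 19 * PowerSeries.X ^ 2 + 23 * PowerSeries.X ^ 3
          - 7 * PowerSeries.X ^ 4 - 7 * PowerSeries.X ^ 5 + 4 * PowerSeries.X ^ 6 : ℚ⟦X⟧) : ℚ⸨X⸩)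
      / ((PowerSeries.X * (1 - PowerSeries.X) ^ 2
            * (1 - 3 * PowerSeries.X + PowerSeries.X ^ 2)
            * (1 - PowerSeries.X - PowerSeries.X ^ 2) : ℚ⟦X⟧) : ℚ⸨X⸩) := by
  have hne : (PowerSeries.X * (1 - PowerSeries.X) ^ 2
      * (1 - 3 * PowerSeries.X + PowerSeries.X ^ 2)
      * (1 - PowerSeries.X - PowerSeries.X ^ 2) : ℚ⟦X⟧) ≠ 0 := by
    refine mul_ne_zero (mul_ne_zero (mul_ne_zero PowerSeries.X_ne_zero (pow_ne_zero 2 ?_)) ?_) ?_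
    all_goals exact fun h => by simpa using congrArg PowerSeries.constantCoeff h
  rw [eq_div_iff, ← PowerSeries.coe_mul, avoiderSeries_mul]
  exact fun h => hne (HahnSeries.ofPowerSeries_injective (h.trans (map_zero _).symm))
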